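/- Let $N$ be a finite set of agents and $\Theta$ a set of atomic propositions. The CLCD formulas are given by \[\phi ::= p \mid \neg\phi \mid \phi\wedge\phi \mid [H]\phi \mid K_i\phi \mid C_G\phi \mid D_G\phi ,\] where $p\in\Theta$, $i\in N$, $H\subseteq N$ and $\emptyset\neq G\subseteq N$. A function $E$ assigning to each $G\subseteq N$ a family $E(G)$ of subsets of a set $S$ is truly playable if (E1) $\emptyset\notin E(G)$ for all $G$; (E2) $S\in E(G)$ for all $G$; (E3) if $S\setminus X\notin E(\emptyset)$ then $X\in E(N)$; (E4) if $X\subseteq Y\subseteq S$ and $X\in E(G)$ then $Y\in E(G)$; (E5) if $G_1\cap G_2=\emptyset$, $X\in E(G_1)$ and $Y\in E(G_2)$, then $X\cap Y\in E(G_1\cup G_2)$; (E6) $E(\emptyset)$ has an inclusion-minimal member. A model (epistemic coalition model) is a tuple $M=(S,E,\{\sim_i\}_{i\in N},V)$ where $S$ is a non-empty set of states, $E(s)$ is a truly playable function as above for each $s\in S$, each $\sim_i$ is an equivalence relation on $S$, and $V(s)\subseteq\Theta$ for each $s\in S$. Truth at a state is defined by: $M,s\models p$ iff $p\in V(s)$;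 the usual clauses for $\neg$ and $\wedge$; $M,s\models[H]\phi$ iff $\{t\in S: M,t\models\phi\}\in E(s)(H)$; $M,s\models K_i\phi$ (respectively $C_G\phi$, $D_G\phi$) iff $M,t\models\phi$ for all $t\in S$ such that $(s,t)$ is in $\sim_i$ (respectively in the transitive closure of $\bigcup_{i\in G}\sim_i$, in $\bigcap_{i\in G}\sim_i$). A pseudomodel is a model together with an equivalence relation $R_G$ on $S$ for each $\emptyset\neq G\subseteq N$, such that $R_{\{i\}}=\,\sim_i$ for all $i\in N$, and $R_H\subseteq R_G$ whenever $\emptyset\neq G\subseteq H\subseteq N$. Truth at a state of a pseudomodel is defined as for a model, except that $D_G\phi$ is true at $s$ iff $\phi$ is true at every $t$ with $(s,t)\in R_G$. A pseudomodel is finite if its set of states is finite. Theorem. Every CLCD formula that is true at some state of a finite pseudomodel is true at some state of a model. -/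

import Mathlib

universe u v w

namespace CLCD

/-- Nonempty coalitions of agents. -/
abbrev NECoalition (N : Type v) : Type v := {G : Set N // G.Nonempty}

/-- Formulas of coalition logic with common and distributed knowledge, over the set `N` of agents
and the set `Θ` of atomic propositions. -/
inductive Formula (N : Type v) (Θ : Type w) : Type (max v w)
  | atom (p : Θ) : Formula N Θ
  | neg (φ : Formula N Θ) : Formula N Θ
  | and (φ ψ : Formula N Θ) : Formula N Θ
  /-- `[H] φ`, for any coalition `H`, possibly empty. -/
  | coal (H : Set N) (φ : Formula N Θ) : Formula N Θ
  /-- `K_i φ`. -/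
  | know (i : N) (φ : Formula N Θ) : Formula N Θ
  /-- `C_G φ`, for a nonempty coalition `G`. -/
  | common (G : NECoalition N) (φ : Formula N Θ) : Formula N Θ
  /-- `D_G φ`, for a nonempty coalition `G`. -/
  | dist (G : NECoalition N) (φ : Formula N Θ) : Formula N Θ

/-- The non-monotonic core of a family of sets: its inclusion-minimal members. -/
def nonmonotonicCore {S : Type u} (𝓕 : Set (Set S)) : Set (Set S) :=
  {X | X ∈ 𝓕 ∧ ¬ ∃ Y, Y ∈ 𝓕 ∧ Y ⊂ X}

/-- True playability of an effectivity function over the agents `N` and the states `S`. -/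
structure TrulyPlayable {N : Type v} {S : Type u} (E : Set N → Set (Set S)) : Prop where
  liveness : ∀ G, (∅ : Set S) ∉ E G
  safety : ∀ G, (Set.univ : Set S) ∈ E G
  maximality : ∀ X : Set S, Xᶜ ∉ E ∅ → X ∈ E Set.univ
  monotonicity : ∀ G, ∀ X Y : Set S, X ⊆ Y → X ∈ E G → Y ∈ E G
  superadditivity : ∀ G₁ G₂ : Set N, ∀ X Y : Set S, G₁ ∩ G₂ = ∅ →
    X ∈ E G₁ → Y ∈ E G₂ → X ∩ Y ∈ E (G₁ ∪ G₂)
  core_nonempty : nonmonotonicCore (E ∅) ≠ ∅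

/-- A coalition model. -/
structure CoalitionModel (N : Type v) (Θ : Type w) where
  State : Type u
  nonempty : Nonempty State
  /-- `E s G` is the family of the sets of states for which `G` is effective at `s`. -/
  E : State → Set N → Set (Set State)
  trulyPlayable : ∀ s, TrulyPlayable (E s)
  V : State → Set Θ

/-- An epistemic coalition model, simply called a model. -/
structure Model (N : Type v) (Θ : Type w) extends CoalitionModel.{u} N Θ where
  sim : N → State → State → Prop
  sim_equivalence : ∀ i, Equivalence (sim i)

/-- A pseudomodel: a model with, in addition, a relation `R G` for each nonempty coalition `G`. -/
structure Pseudomodel (N : Type v) (Θ : Type w) extends Model.{u} N Θ where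
  R : NECoalition N → State → State → Prop
  R_equivalence : ∀ G, Equivalence (R G)
  R_singleton : ∀ i : N, R ⟨{i}, Set.singleton_nonempty i⟩ = sim i
  R_antitone : ∀ G H : NECoalition N, G.1 ⊆ H.1 → ∀ s t, R H s t → R G s t

variable {N : Type v} {Θ : Type w}

/-- Truth at a state of a model, when the operators `D_G` are interpreted by given relations
`D G`. -/
def Model.SatWith (M : Model.{u} N Θ) (D : NECoalition N → M.State → M.State → Prop) :
    M.State → Formula N Θ → Prop
  | s, .atom p => p ∈ M.V s
  | s, .neg φ => ¬ M.SatWith D s φ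
  | s, .and φ ψ => M.SatWith D s φ ∧ M.SatWith D s ψ
  | s, .coal H φ => {t | M.SatWith D t φ} ∈ M.E s H
  | s, .know i φ => ∀ t, M.sim i s t → M.SatWith D t φ
  | s, .common G φ =>
      ∀ t, Relation.TransGen (fun x y => ∃ i ∈ G.1, M.sim i x y) s t → M.SatWith D t φ
  | s, .dist G φ => ∀ t, D G s t → M.SatWith D t φ

/-- Truth at a state of a model: `D_G` is interpreted by the intersection of the relations
`sim i`, `i ∈ G`. -/
def Model.Sat (M : Model.{u} N Θ) : M.State → Formula N Θ → Prop :=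
  M.SatWith (fun G s t => ∀ i ∈ G.1, M.sim i s t)

/-- Truth at a state of a pseudomodel: `D_G` is interpreted by the relation `R G`. -/
def Pseudomodel.Sat (P : Pseudomodel.{u} N Θ) : P.State → Formula N Θ → Prop :=
  P.toModel.SatWith P.R

end CLCD

namespace CLCD

/-! The pseudomodel is covered by a model with states `(s, a)`, where `a` holds one formal
ℤ-combination of states per nonempty coalition. Crossing an `R G`-edge from `s` to `t` records `t -
s` in the entry of `G`. Each agent's relation is equality of certain invariants, hence an
equivalence. If all members of `G` relate two states, these invariants determine the `R G`-class
(`R_of_forall_coverSim`); conversely every `R G`-edge lifts (`exists_forall_coverSim`). So the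
projection is a bounded morphism taking intersections of the agents' relations to `R G`, and with
lifted effectivity functions it preserves truth. -/

/-- The effectivity function on `T` induced along `f : T → S` by one on `S`. The grand coalition can
also force every set whose image it can force. -/
def liftEffectivity {N : Type v} {S T : Type u} (f : T → S) (E : Set N → Set (Set S)) :
    Set N → Set (Set T) :=
  fun G => {X | (G = Set.univ ∧ f '' X ∈ E Set.univ) ∨ ∃ Y ∈ E G, f ⁻¹' Y ⊆ X}

/-- The extra power of the grand coalition adds no preimages, since `f '' (f ⁻¹' Y) = Y`. -/
theorem preimage_mem_liftEffectivity {N : Type v} {S T : Type u} {f : T → S}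
    (hf : Function.Surjective f) {E : Set N → Set (Set S)} (hE : TrulyPlayable E) (G : Set N)
    (Y : Set S) : f ⁻¹' Y ∈ liftEffectivity f E G ↔ Y ∈ E G := by
  refine ⟨?_, fun h => Or.inr ⟨Y, h, subset_rfl⟩⟩
  rintro (⟨rfl, h⟩ | ⟨Z, hZ, h⟩)
  · rwa [Set.image_preimage_eq _ hf] at h
  · exact hE.monotonicity _ _ _ ((Set.preimage_subset_preimage_iff (by simp [hf.range_eq])).1 h) hZ

theorem TrulyPlayable.liftEffectivity {N : Type v} [Nonempty N] {S T : Type u} {f : T → S}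
    (hf : Function.Surjective f) {E : Set N → Set (Set S)} (hE : TrulyPlayable E) :
    TrulyPlayable (liftEffectivity f E) where
  liveness G h := by
    rw [← Set.preimage_empty (f := f), preimage_mem_liftEffectivity hf hE] at h
    exact hE.liveness G h
  safety G := by
    rw [← Set.preimage_univ (f := f), preimage_mem_liftEffectivity hf hE]
    exact hE.safety G
  maximality X h := by
    -- The image clause serves here: if `∅` could force the complement of `f '' X`, it could force
    -- the preimage of that complement, which lies in `Xᶜ`.
    refine Or.inl ⟨rfl, hE.maximality _ fun hX => h (Or.inr ⟨_, hX, ?_⟩)⟩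
    exact fun t ht htX => ht ⟨t, htX, rfl⟩
  monotonicity G X Y hXY := by
    rintro (⟨rfl, h⟩ | ⟨Z, hZ, h⟩)
    · exact Or.inl ⟨rfl, hE.monotonicity _ _ _ (Set.image_mono hXY) h⟩
    · exact Or.inr ⟨Z, hZ, h.trans hXY⟩
  superadditivity G₁ G₂ X Y hG := by
    rintro (⟨rfl, hX⟩ | ⟨X', hX, hXX⟩) (⟨rfl, hY⟩ | ⟨Y', hY, hYY⟩)
    -- With an agent present, `univ` is not disjoint from itself.
    · simp at hG
    · refine Or.inl ⟨by simp, ?_⟩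
      have h := hE.superadditivity _ _ _ _ hG hX hY
      rw [Set.univ_union] at h
      refine hE.monotonicity _ _ _ ?_ h
      rintro _ ⟨⟨t, ht, rfl⟩, ht'⟩
      exact ⟨t, ⟨ht, hYY ht'⟩, rfl⟩
    · refine Or.inl ⟨by simp, ?_⟩
      have h := hE.superadditivity _ _ _ _ hG hX hY
      rw [Set.union_univ] at h
      refine hE.monotonicity _ _ _ ?_ h
      rintro _ ⟨ht', ⟨t, ht, rfl⟩⟩
      exact ⟨t, ⟨hXX ht', ht⟩, rfl⟩
    · exact Or.inr ⟨X' ∩ Y', hE.superadditivity _ _ _ _ hG hX hY,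
        fun t ht => ⟨hXX ht.1, hYY ht.2⟩⟩
  core_nonempty := by
    obtain ⟨Y, hY, hmin⟩ := Set.nonempty_iff_ne_empty.2 hE.core_nonempty
    refine Set.nonempty_iff_ne_empty.1
      ⟨f ⁻¹' Y, (preimage_mem_liftEffectivity hf hE _ _).2 hY, ?_⟩
    rintro ⟨X, ⟨h, -⟩ | ⟨Z, hZ, hZX⟩, hXY⟩
    · exact Set.empty_ne_univ h
    · exact hmin ⟨Z, hZ, (hf.preimage_subset_preimage_iff.1 (hZX.trans hXY.1)),
        fun hYZ => hXY.2 ((Set.preimage_mono hYZ).trans hZX)⟩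

/-- Truth is invariant under surjections that respect the valuation, are bounded morphisms for the
epistemic relations, and along which the effectivity functions are reflected and preserved. -/
theorem Model.satWith_iff_of_boundedMorphism {N : Type v} {Θ : Type w} {M P : Model.{u} N Θ}
    {D : NECoalition N → M.State → M.State → Prop} {R : NECoalition N → P.State → P.State → Prop}
    (f : M.State → P.State) (hV : ∀ x, M.V x = P.V (f x))
    (hE : ∀ x G Y, f ⁻¹' Y ∈ M.E x G ↔ Y ∈ P.E (f x) G)
    (sim_forth : ∀ i x y, M.sim i x y → P.sim i (f x) (f y))
    (sim_back : ∀ i x t, P.sim i (f x) t → ∃ y, f y = t ∧ M.sim i x y)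
    (dist_forth : ∀ G x y, D G x y → R G (f x) (f y))
    (dist_back : ∀ G x t, R G (f x) t → ∃ y, f y = t ∧ D G x y)
    (φ : Formula N Θ) : ∀ x, M.SatWith D x φ ↔ P.SatWith R (f x) φ := by
  induction φ with
  | atom p => intro x; simp only [SatWith, hV]
  | neg φ ih => intro x; simp only [SatWith, ih]
  | and φ ψ ih₁ ih₂ => intro x; simp only [SatWith, ih₁, ih₂]
  | coal H φ ih =>
    intro x
    simp only [SatWith, ih]
    exact hE x H {t | P.SatWith R t φ}
  | know i φ ih =>
    intro x
    simp only [SatWith, ih]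
    refine ⟨fun h t ht => ?_, fun h y hy => h _ (sim_forth i x y hy)⟩
    obtain ⟨y, rfl, hy⟩ := sim_back i x t ht
    exact h y hy
  | common G φ ih =>
    intro x
    simp only [SatWith, ih]
    have step : ∀ z t, (∃ i ∈ G.1, P.sim i (f z) t) → ∃ y, f y = t ∧ ∃ i ∈ G.1, M.sim i z y := by
      rintro z t ⟨i, hi, h⟩
      obtain ⟨y, hy, h⟩ := sim_back i z t h
      exact ⟨y, hy, i, hi, h⟩
    refine ⟨fun h t ht => ?_, fun h y hy => h _ (hy.lift f ?_)⟩
    · suffices ∃ y, f y = t ∧ Relation.TransGen (fun x y => ∃ i ∈ G.1, M.sim i x y) x y by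
        obtain ⟨y, rfl, hy⟩ := this
        exact h y hy
      induction ht with
      | single hb =>
        obtain ⟨y, hy, h⟩ := step x _ hb
        exact ⟨y, hy, .single h⟩
      | tail _ hbc ih' =>
        obtain ⟨z, rfl, hz⟩ := ih'
        obtain ⟨y, hy, h⟩ := step z _ hbc
        exact ⟨y, hy, hz.tail h⟩
    · rintro a b ⟨i, hi, hab⟩
      exact ⟨i, hi, sim_forth i a b hab⟩
  | dist G φ ih =>
    intro x
    simp only [SatWith, ih]
    refine ⟨fun h t ht => ?_, fun h y hy => h _ (dist_forth G x y hy)⟩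
    obtain ⟨y, rfl, hy⟩ := dist_back G x t ht
    exact h y hy

namespace Pseudomodel

variable {N : Type v} {Θ : Type w} (P : Pseudomodel.{u} N Θ)

/-- `R G` as a setoid. -/
def setoid (G : NECoalition N) : Setoid P.State := ⟨P.R G, P.R_equivalence G⟩

/-- The pushforward of a formal combination of states to the classes of `R G`. -/
noncomputable def classSum (G : NECoalition N) (a : P.State →₀ ℤ) : Quotient (P.setoid G) →₀ ℤ :=
  a.mapDomain (Quotient.mk (P.setoid G))

theorem classSum_single_eq_iff (G : NECoalition N) (s t : P.State) :
    P.classSum G (Finsupp.single s 1) = P.classSum G (Finsupp.single t 1) ↔ P.R G s t := by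
  rw [classSum, classSum, Finsupp.mapDomain_single, Finsupp.mapDomain_single,
    Finsupp.single_left_inj one_ne_zero]
  exact Quotient.eq (r := P.setoid G)

theorem classSum_eq_of_subset {G H : NECoalition N} (hGH : G.1 ⊆ H.1) {a b : P.State →₀ ℤ}
    (h : P.classSum H a = P.classSum H b) : P.classSum G a = P.classSum G b := by
  let g : Quotient (P.setoid H) → Quotient (P.setoid G) :=
    Quotient.map' id fun s t hst => P.R_antitone G H hGH s t hst
  have hg : ∀ c, P.classSum G c = (P.classSum H c).mapDomain g := fun c => by
    rw [classSum, classSum, ← Finsupp.mapDomain_comp]; rfl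
  rw [hg, hg, h]

variable {ι : Type} [Fintype ι] (e : ι → NECoalition N)

/-- The relation of agent `i` on the pairs of a state and a family, indexed by coalitions, of formal
combinations of states. A step of `R G` from `s` to `t` adds `t - s` to the entry of `G`. -/
def coverSim (i : N) (x y : P.State × (ι → P.State →₀ ℤ)) : Prop :=
  (∀ j, i ∉ (e j).1 → x.2 j = y.2 j) ∧
  (∀ j, P.classSum (e j) (x.2 j) = P.classSum (e j) (y.2 j)) ∧
  ∑ j, x.2 j - Finsupp.single x.1 1 = ∑ j, y.2 j - Finsupp.single y.1 1

theorem coverSim_equivalence (i : N) : Equivalence (P.coverSim e i) where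
  refl _ := ⟨fun _ _ => rfl, fun _ => rfl, rfl⟩
  symm h := ⟨fun j hj => (h.1 j hj).symm, fun j => (h.2.1 j).symm, h.2.2.symm⟩
  trans h h' := ⟨fun j hj => (h.1 j hj).trans (h'.1 j hj), fun j => (h.2.1 j).trans (h'.2.1 j),
    h.2.2.trans h'.2.2⟩

/-- Every entry keeps its class sum modulo `R G`: if `G ⊆ e j`, because `R (e j)` refines `R G`;
otherwise some member of `G` is outside `e j` and fixes the entry. The conserved total then makes
`x.1` and `y.1` equal modulo `R G`. -/
theorem R_of_forall_coverSim (G : NECoalition N) {x y : P.State × (ι → P.State →₀ ℤ)}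
    (h : ∀ i ∈ G.1, P.coverSim e i x y) : P.R G x.1 y.1 := by
  obtain ⟨i₀, hi₀⟩ := G.2
  have hj : ∀ j, P.classSum G (x.2 j) = P.classSum G (y.2 j) := by
    intro j
    by_cases hG : G.1 ⊆ (e j).1
    · exact P.classSum_eq_of_subset hG ((h i₀ hi₀).2.1 j)
    · obtain ⟨i, hi, hij⟩ := Set.not_subset.1 hG
      rw [(h i hi).1 j hij]
  have hs := (h i₀ hi₀).2.2
  rw [sub_eq_sub_iff_add_eq_add] at hs
  have hc := congrArg (P.classSum G) hs
  simp only [classSum, Finsupp.mapDomain_add, Finsupp.mapDomain_finsetSum] at hc hj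
  simp only [hj] at hc
  rw [← P.classSum_single_eq_iff G]
  exact (add_left_cancel hc).symm

theorem exists_forall_coverSim (he : Function.Surjective e) (G : NECoalition N)
    (x : P.State × (ι → P.State →₀ ℤ)) (t : P.State) (h : P.R G x.1 t) :
    ∃ y : P.State × (ι → P.State →₀ ℤ), y.1 = t ∧ ∀ i ∈ G.1, P.coverSim e i x y := by
  classical
  obtain ⟨j₀, rfl⟩ := he G
  -- The added `t - s` vanishes modulo `R (e j₀)` and offsets the change of base state.
  refine ⟨(t, x.2 + Pi.single j₀ (Finsupp.single t 1 - Finsupp.single x.1 1)), rfl,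
    fun i hi => ⟨fun j hj => ?_, fun j => ?_, ?_⟩⟩
  · have : j ≠ j₀ := by rintro rfl; exact hj hi
    simp [this]
  · by_cases hj : j = j₀
    · subst hj
      have hst := (P.classSum_single_eq_iff _ _ _).2 h
      simp only [Pi.add_apply, Pi.single_eq_same]
      have hx : x.2 j + (Finsupp.single t 1 - Finsupp.single x.1 1) + Finsupp.single x.1 1
          = x.2 j + Finsupp.single t 1 := by abel
      have hc := congrArg (P.classSum (e j)) hx
      simp only [classSum] at hst hc ⊢
      rw [Finsupp.mapDomain_add, Finsupp.mapDomain_add (v₁ := x.2 j) (v₂ := Finsupp.single t 1),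
        ← hst] at hc
      exact (add_right_cancel hc).symm
    · simp [hj]
  · simp only [Pi.add_apply, Finset.sum_add_distrib, Finset.sum_pi_single',
      Finset.mem_univ, if_true]
    abel

/-- The model covering a pseudomodel, in which distributed knowledge is the standard one. -/
noncomputable def cover [Nonempty N] : Model.{u} N Θ where
  State := P.State × (ι → P.State →₀ ℤ)
  nonempty := P.nonempty.map fun s => (s, 0)
  E x := liftEffectivity Prod.fst (P.E x.1)
  trulyPlayable x := (P.trulyPlayable x.1).liftEffectivity Prod.fst_surjective
  V x := P.V x.1
  sim := P.coverSim e
  sim_equivalence := P.coverSim_equivalence e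

theorem cover_sat_iff [Nonempty N] (he : Function.Surjective e) (φ : Formula N Θ)
    (x : (P.cover e).State) : (P.cover e).Sat x φ ↔ P.Sat x.1 φ := by
  refine Model.satWith_iff_of_boundedMorphism (M := P.cover e) (P := P.toModel) Prod.fst
    (fun _ => rfl)
    (fun x G Y => preimage_mem_liftEffectivity Prod.fst_surjective (P.trulyPlayable x.1) G Y)
    (fun i x y h => ?_) (fun i x t h => ?_) (fun G x y h => P.R_of_forall_coverSim e G h)
    (fun G x t h => P.exists_forall_coverSim e he G x t h) φ x
  -- An agent's relation is the distributed one for its singleton.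
  · rw [← P.R_singleton]
    exact P.R_of_forall_coverSim e _ fun j hj => by rwa [Set.mem_singleton_iff.1 hj]
  · rw [← P.R_singleton] at h
    obtain ⟨y, hy, hxy⟩ := P.exists_forall_coverSim e he _ x t h
    exact ⟨y, hy, hxy i rfl⟩

end Pseudomodel

end CLCD

theorem mainTheorem8 {N : Type v} [Finite N] {Θ : Type w} (φ : CLCD.Formula N Θ)
    (h : ∃ P : CLCD.Pseudomodel.{u} N Θ, Finite P.State ∧ ∃ s : P.State, P.Sat s φ) :
    ∃ M : CLCD.Model.{u} N Θ, ∃ s : M.State, M.Sat s φ := by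
  obtain ⟨P, -, s, hs⟩ := h
  cases isEmpty_or_nonempty N with
  | inl hN =>
    -- Without agents there are no nonempty coalitions, so `P` itself serves.
    have hD : P.R = fun G s t => ∀ i ∈ G.1, P.sim i s t :=
      funext fun G => hN.elim G.2.some
    refine ⟨P.toModel, s, ?_⟩
    rwa [CLCD.Pseudomodel.Sat, hD] at hs
  | inr hN =>
    let e := (Finite.equivFin (CLCD.NECoalition N)).symm
    exact ⟨P.cover e, (s, 0), (P.cover_sat_iff e e.surjective φ (s, 0)).2 hs⟩
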